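/- Let $T$ be a complete first-order theory in a language $L$, and assume that $T$ has NIP (no formula has the independence property modulo $T$). Let $M\models T$ (for instance a monster model), let $A\subseteq M$, let $x$ be a finite or infinite tuple of variables, and let $\mu=|T|+|x|$, where $|T|=|L|+\aleph_0$. Let $L_x(A)$ be the Boolean algebra of formulas $\varphi(x,a)$ in $x$ over $A$ up to equivalence in $M$. A *Keisler measure* in $x$ over $A$ is a finitely additive probability measure on $L_x(A)$. For a Boolean algebra $\mathcal B$, a *$\mathcal B$-type* in $x$ over $A$ is a homomorphism of Boolean algebras $L_x(A)\to\mathcal B$; thus a $2^\mu$-type is the same thing as a sequence of $\mu$ complete types in $x$ over $A$. For an elementary permutation $\pi$ of $A$ (a bijection $A\to A$ preserving the truth in $M$ of all formulas at tuples from $A$) and a function $F$ on $L_x(A)$, put $(\pi*F)(\varphi(x,a))=F(\varphi(x,\pi^{-1}(a)))$. Two $\mathcal B$-types $p_1,p_2$ are *elementarily conjugate* if $p_2=\pi*p_1$ for some elementary permutation $\pi$ of $A$, and two Keisler measures $\lambda,\lambda'$ are *conjugate* if $\lambda'=\pi*\lambda$ for some elementary permutation $\pi$ of $A$. Then there is an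 injection from the set of Keisler measures in $x$ over $A$ to the set of $2^\mu$-types in $x$ over $A$ such that, whenever the images of two Keisler measures $\lambda,\lambda'$ are elementarily conjugate, $\lambda$ and $\lambda'$ are conjugate. -/

import Mathlib

open Cardinal
open FirstOrder FirstOrder.Language

universe u v w u' w'

namespace FirstOrder.Language

/-- The complete theory `T` has NIP: for every partitioned formula `φ(x; y)` there is a finite
bound `N` such that no `N` parameter tuples `a_0, …, a_{N-1}` in a model of `T` are shattered
by the instances `φ(b; y)`, i.e. it never happens that for every `s ⊆ N` some tuple `b`
satisfies `φ(b; a_i) ↔ i ∈ s`. -/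
def Theory.IsNIP {L : Language.{u, v}} (T : L.Theory) : Prop :=
  ∀ (k m : ℕ) (φ : L.Formula (Fin k ⊕ Fin m)), ∃ N : ℕ,
    ∀ (M : Theory.ModelType.{u, v, max u v} T) (a : Fin N → Fin m → M),
      ¬ ∀ s : Set (Fin N), ∃ b : Fin k → M, ∀ i, φ.Realize (Sum.elim b (a i)) ↔ i ∈ s

section

variable {L : Language.{u, v}} {M : Type w} [L.Structure M] {A : Set M} {α : Type u'}

/-- The element of the Boolean algebra `L_x(A)` given by the formula `φ(x, a)`, where `a` is a
finite tuple from `A`. Formulas over `A` up to equivalence in `M` are identified with the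
`A`-definable subsets of `M ^ x`, which are the elements of `L.DefinableSet A α`. -/
def DefinableSet.inst {n : ℕ} (φ : L.Formula (α ⊕ Fin n)) (a : Fin n → A) :
    L.DefinableSet A α :=
  ⟨{x | φ.Realize (Sum.elim x fun i => (a i : M))}, by
    refine Set.definable_iff_exists_formula_sum.2
      ⟨φ.relabel (Sum.elim Sum.inr fun i => Sum.inl (a i)), ?_⟩
    ext x
    simp only [Set.mem_ofPred_eq, Formula.realize_relabel]
    refine iff_of_eq (congrArg _ ?_)
    funext j
    rcases j with j | j <;> rfl⟩

/-- A permutation `π` of `A` is elementary if it preserves the truth in `M` of all formulas at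
finite tuples from `A`. -/
def IsElementaryPerm (L : Language.{u, v}) {M : Type w} [L.Structure M] {A : Set M}
    (π : A ≃ A) : Prop :=
  ∀ (n : ℕ) (φ : L.Formula (Fin n)) (a : Fin n → A),
    φ.Realize (fun i => (π (a i) : M)) ↔ φ.Realize (fun i => (a i : M))

/-- `G = π * F` for functions on `L_x(A)`, that is, `G (φ(x, a)) = F (φ(x, π⁻¹ a))` for every
formula `φ(x, y)` and every tuple `a` from `A`. -/
def IsTranslate {X : Type*} (π : A ≃ A) (F G : L.DefinableSet A α → X) : Prop :=
  ∀ (n : ℕ) (φ : L.Formula (α ⊕ Fin n)) (a : Fin n → A),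
    F (DefinableSet.inst φ fun i => π.symm (a i)) = G (DefinableSet.inst φ a)

end

/-- A Keisler measure in `x` over `A`: a finitely additive probability measure on `L_x(A)`.
The variables of the tuple `x` are indexed by `α`. -/
@[ext]
structure KeislerMeasure (L : Language.{u, v}) {M : Type w} [L.Structure M] (A : Set M)
    (α : Type u') where
  /-- The measure of a definable set. -/
  toFun : L.DefinableSet A α → ℝ
  nonneg' : ∀ s, 0 ≤ toFun s
  map_top' : toFun ⊤ = 1
  map_sup' : ∀ s t, Disjoint s t → toFun (s ⊔ t) = toFun s + toFun t

/-- A complete `B`-type in `x` over `A`: a homomorphism of Boolean algebras from `L_x(A)`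
to `B`. -/
abbrev BooleanType (L : Language.{u, v}) {M : Type w} [L.Structure M] (A : Set M)
    (α : Type u') (B : Type w') [BooleanAlgebra B] :=
  BoundedLatticeHom (L.DefinableSet A α) B

section

variable {L : Language.{u, v}} {M : Type w} [L.Structure M] {A : Set M} {α : Type u'}

/-- Two Keisler measures over `A` are conjugate if an elementary permutation of `A` takes one to
the other. -/
def KeislerMeasure.Conjugate (l₁ l₂ : KeislerMeasure L A α) : Prop :=
  ∃ π : A ≃ A, IsElementaryPerm L π ∧ IsTranslate π l₁.toFun l₂.toFun

/-- Two `B`-types over `A` are elementarily conjugate if they are in the same orbit of the group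
of elementary permutations of `A`. -/
def BooleanType.ElementarilyConjugate {B : Type w'} [BooleanAlgebra B]
    (p₁ p₂ : BooleanType L A α B) : Prop :=
  ∃ π : A ≃ A, IsElementaryPerm L π ∧ IsTranslate π (p₁ : L.DefinableSet A α → B) p₂

end

end FirstOrder.Language

/-! By NIP, the instances over `A` of one parameter-free formula `φ(x; y)` form a
Vapnik–Chervonenkis class (`Theory.IsNIP.exists_shattersNone`). Such a class has ε-approximations of
size independent of the measure (`exists_forall_two_pow_approx`), so every Keisler measure is within
`ε` of the average of `N(φ, ε)` complete types, simultaneously on all instances of `φ`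
(`exists_forall_average_approx`).

Concatenating these blocks over all `φ` and all `ε = 1 / (k + 1)` gives a sequence of at most `μ`
types. The position of a block depends only on `(φ, k)`, so the measure is recovered as a limit of
averages over fixed positions. This recovery commutes with permutations of `A`; the identity
permutation gives injectivity. -/

namespace EpsilonApproximation

open Finset

/-! ### Discrepancy by random signs -/

/-- The sign attached to a Boolean. -/
def sign (b : Bool) : ℝ := if b then 1 else -1

/-- A finite family of vectors with entries in `[-1, 1]` has a common choice of signs for which all
signed sums are small. -/
theorem exists_signs_forall_abs_sum_le {ι : Type*} [Fintype ι] (V : Finset (ι → ℝ))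
    (hV : ∀ v ∈ V, ∀ i, |v i| ≤ 1) {t : ℝ} (ht : 0 < t) :
    ∃ σ : ι → Bool, ∀ v ∈ V,
      |∑ i, sign (σ i) * v i| ≤ Real.log (2 * V.card) / t + t * Fintype.card ι / 2 := by
  classical
  -- Exponential moments: the sum over all sign choices factorises, and each factor is controlled by
  -- `cosh y ≤ exp (y ^ 2 / 2)`.
  have sum_exp (r : ℝ) (v : ι → ℝ) : ∑ σ : ι → Bool, Real.exp (r * ∑ i, sign (σ i) * v i) =
      ∏ i, (2 * Real.cosh (r * v i)) := by
    have (σ : ι → Bool) : Real.exp (r * ∑ i, sign (σ i) * v i) =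
        ∏ i, Real.exp (r * (sign (σ i) * v i)) := by
      rw [← Real.exp_sum, mul_sum]
    simp_rw [this]
    rw [← Fintype.prod_sum (fun i b => Real.exp (r * (sign b * v i)))]
    refine prod_congr rfl fun i _ => ?_
    simp [sign, Real.cosh_eq]
    ring
  have prod_le (r : ℝ) (hr : |r| = t) (v : ι → ℝ) (hv : v ∈ V) :
      ∏ i, (2 * Real.cosh (r * v i)) ≤
        2 ^ Fintype.card ι * Real.exp (t ^ 2 / 2 * Fintype.card ι) := by
    have hi (i : ι) : 2 * Real.cosh (r * v i) ≤ 2 * Real.exp (t ^ 2 / 2) := by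
      have h1 : (r * v i) ^ 2 ≤ t ^ 2 := by
        rw [← hr, mul_pow, sq_abs]
        have : v i ^ 2 ≤ 1 := (sq_le_one_iff_abs_le_one _).2 (hV v hv i)
        nlinarith [sq_nonneg r]
      have h2 : Real.exp ((r * v i) ^ 2 / 2) ≤ Real.exp (t ^ 2 / 2) :=
        Real.exp_le_exp.2 (by linarith)
      linarith [Real.cosh_le_exp_half_sq (r * v i)]
    calc ∏ i, (2 * Real.cosh (r * v i)) ≤ ∏ _i : ι, (2 * Real.exp (t ^ 2 / 2)) :=
          prod_le_prod (fun i _ => by positivity) fun i _ => hi i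
      _ = _ := by
          rw [Finset.prod_const, mul_pow, card_univ, ← Real.exp_nat_mul, mul_comm (_ : ℝ) (t ^ 2 / 2)]
  -- Some choice is no worse than the average; both exponents `t` and `-t` are included in order to
  -- control `|S|`.
  obtain ⟨σ, -, hσ⟩ : ∃ σ ∈ (univ : Finset (ι → Bool)),
      ∑ v ∈ V, (Real.exp (t * ∑ i, sign (σ i) * v i) + Real.exp (-t * ∑ i, sign (σ i) * v i)) ≤
        2 * V.card * Real.exp (t ^ 2 / 2 * Fintype.card ι) := by
    refine exists_le_of_sum_le univ_nonempty ?_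
    rw [sum_comm]
    simp_rw [Finset.sum_add_distrib, sum_exp]
    rw [← Finset.sum_add_distrib]
    refine (sum_le_card_nsmul V _ _ fun v hv =>
      add_le_add (prod_le t (abs_of_pos ht) v hv) (prod_le (-t) (by simp [abs_of_pos ht]) v hv)).trans
      (le_of_eq ?_)
    simp
    ring
  refine ⟨σ, fun v hv => ?_⟩
  have hsingle := (Finset.single_le_sum
    (f := fun v : ι → ℝ => Real.exp (t * ∑ i, sign (σ i) * v i) +
      Real.exp (-t * ∑ i, sign (σ i) * v i))
    (fun _ _ => (add_pos (Real.exp_pos _) (Real.exp_pos _)).le) hv).trans hσ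
  beta_reduce at hsingle
  generalize ∑ i, sign (σ i) * v i = S at hsingle ⊢
  have hexp : Real.exp (t * |S|) ≤ 2 * V.card * Real.exp (t ^ 2 / 2 * Fintype.card ι) := by
    refine le_trans ?_ hsingle
    rcases abs_choice S with h | h <;> rw [h]
    · exact le_add_of_nonneg_right (Real.exp_pos _).le
    · rw [mul_neg, ← neg_mul]
      exact le_add_of_nonneg_left (Real.exp_pos _).le
  have hpos : (0 : ℝ) < 2 * V.card := by
    have := card_pos.2 ⟨v, hv⟩
    positivity
  have hlog := Real.log_le_log (Real.exp_pos _) hexp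
  rw [Real.log_exp, Real.log_mul hpos.ne' (Real.exp_pos _).ne', Real.log_exp] at hlog
  have : |S| ≤ (Real.log (2 * V.card) + t ^ 2 / 2 * Fintype.card ι) / t := by
    rw [le_div_iff₀ ht]
    linarith
  refine this.trans (le_of_eq ?_)
  field_simp

/-! ### Vapnik–Chervonenkis classes and ε-approximations by repeated halving -/

/-- The family `S` of sets shatters no `n` points. -/
def ShattersNone {X : Type*} {C : Type*} (S : C → Set X) (n : ℕ) : Prop :=
  ∀ y : Fin n → X, ¬ ∀ s : Set (Fin n), ∃ c, ∀ i, y i ∈ S c ↔ i ∈ s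

open Classical in
/-- The family of traces of `S` on the points `x`. -/
noncomputable def traces {X : Type*} {C : Type*} (S : C → Set X) {κ : Type*} [Fintype κ]
    (x : κ → X) : Finset (Finset κ) :=
  {s | ∃ c, ∀ i, i ∈ s ↔ x i ∈ S c}

/-- The Sauer–Shelah lemma. A crude polynomial bound is enough, since only its logarithm enters the
discrepancy. -/
theorem card_traces_le {X : Type*} {C : Type*} {S : C → Set X} {d : ℕ}
    (hS : ShattersNone S (d + 1)) {κ : Type*} [Fintype κ] (x : κ → X) :
    (traces S x).card ≤ (d + 1) * (Fintype.card κ + 1) ^ d := by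
  classical
  have hdim : (traces S x).vcDim ≤ d := by
    refine Finset.sup_le fun s hs => ?_
    rw [mem_shatterer] at hs
    by_contra! hlt
    obtain ⟨r, hrs, hr⟩ := exists_subset_card_eq (Nat.succ_le_of_lt hlt)
    replace hs := hs.mono_right hrs
    let e : Fin (d + 1) ≃ r := (Fintype.equivFinOfCardEq (by simpa using hr)).symm
    refine hS (fun i => x (e i)) fun u => ?_
    obtain ⟨a, ha, hra⟩ := hs (t := r.filter fun j => ∃ i ∈ u, (e i : κ) = j) (filter_subset _ _)
    obtain ⟨c, hc⟩ := (mem_filter.1 ha).2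
    refine ⟨c, fun i => ?_⟩
    have h := Finset.ext_iff.1 hra (e i)
    simp only [mem_inter, mem_filter, coe_mem, true_and] at h
    rw [← hc, h]
    refine ⟨fun ⟨j, hj, hji⟩ => ?_, fun hi => ⟨i, hi, rfl⟩⟩
    rwa [← e.injective (Subtype.ext hji)]
  calc (traces S x).card ≤ ∑ k ∈ Iic (traces S x).vcDim, (Fintype.card κ).choose k :=
        (card_le_card_shatterer _).trans card_shatterer_le_sum_vcDim
    _ ≤ ∑ k ∈ Iic d, (Fintype.card κ).choose k :=
        sum_le_sum_of_subset (Iic_subset_Iic.2 hdim)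
    _ ≤ ∑ _k ∈ Iic d, (Fintype.card κ + 1) ^ d := by
        refine sum_le_sum fun k hk => (Nat.choose_le_pow _ _).trans ?_
        exact (Nat.pow_le_pow_left (Nat.le_succ _) k).trans
          (Nat.pow_le_pow_right (Nat.succ_pos _) (mem_Iic.1 hk))
    _ = _ := by simp

open Classical in
/-- The proportion of the points `x i` lying in `s`. -/
noncomputable def freq {X : Type*} {ι : Type*} [Fintype ι] (x : ι → X) (s : Set X) : ℝ :=
  (∑ i, if x i ∈ s then (1 : ℝ) else 0) / Fintype.card ι

theorem freq_comp_equiv {X : Type*} {ι κ : Type*} [Fintype ι] [Fintype κ] (e : κ ≃ ι) (x : ι → X)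
    (s : Set X) : freq (x ∘ e) s = freq x s := by
  classical
  rw [freq, freq, Fintype.card_congr e]
  congr 1
  exact e.sum_comp fun i => if x i ∈ s then (1 : ℝ) else 0

/-- In a family of bounded Vapnik–Chervonenkis dimension, half of the points can be
discarded with little effect on the frequencies. -/
theorem exists_halving {X : Type*} {C : Type*} {S : C → Set X} {d : ℕ}
    (hS : ShattersNone S (d + 1)) {ι : Type*} [Fintype ι] [Nonempty ι] (x : ι × Bool → X)
    {t : ℝ} (ht : 0 < t) :
    ∃ y : ι → X, ∀ c, |freq y (S c) - freq x (S c)| ≤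
      (Real.log (2 * ((d + 1) * (2 * Fintype.card ι + 1) ^ d)) / t + t * Fintype.card ι / 2) /
        (2 * Fintype.card ι) := by
  classical
  -- The sign at `i` selects one point of the pair `(i, true)`, `(i, false)`; the change in
  -- frequency is then the signed sum of `vec` divided by the number of points.
  let vec (s : Finset (ι × Bool)) (i : ι) : ℝ :=
    (if (i, true) ∈ s then 1 else 0) - if (i, false) ∈ s then 1 else 0
  obtain ⟨σ, hσ⟩ := exists_signs_forall_abs_sum_le ((traces S x).image vec) (by
    intro v hv i
    obtain ⟨s, -, rfl⟩ := mem_image.1 hv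
    simp only [vec]
    split_ifs <;> norm_num) ht
  refine ⟨fun i => x (i, σ i), fun c => ?_⟩
  let s : Finset (ι × Bool) := {p | x p ∈ S c}
  have hs : s ∈ traces S x := by
    simp only [traces, mem_filter, mem_univ, true_and]
    exact ⟨c, by simp [s]⟩
  have hn : (0 : ℝ) < Fintype.card ι := by exact_mod_cast Fintype.card_pos
  have hle := hσ _ (mem_image_of_mem vec hs)
  have hcard : (((traces S x).image vec).card : ℝ) ≤ (d + 1) * (2 * Fintype.card ι + 1) ^ d := by
    have := (card_image_le (s := traces S x) (f := vec)).trans (card_traces_le hS x)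
    rw [Fintype.card_prod, Fintype.card_bool, mul_comm (Fintype.card ι)] at this
    exact_mod_cast this
  have hpos : (0 : ℝ) < ((traces S x).image vec).card := by
    exact_mod_cast card_pos.2 ⟨_, mem_image_of_mem vec hs⟩
  have hlog := Real.log_le_log (by positivity) (mul_le_mul_of_nonneg_left hcard zero_le_two)
  have hdiff : freq (fun i => x (i, σ i)) (S c) - freq x (S c) =
      (∑ i, sign (σ i) * vec s i) / (2 * Fintype.card ι) := by
    simp only [freq, Fintype.sum_prod_type, Fintype.card_prod, Fintype.card_bool, Nat.cast_mul,
      Nat.cast_ofNat, Fintype.sum_bool]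
    rw [div_sub_div _ _ hn.ne' (by positivity), div_eq_div_iff (by positivity) (by positivity)]
    have : ∑ i, sign (σ i) * vec s i = 2 * (∑ i, if x (i, σ i) ∈ S c then (1 : ℝ) else 0) -
        ∑ i, ((if x (i, true) ∈ S c then (1 : ℝ) else 0) +
          if x (i, false) ∈ S c then (1 : ℝ) else 0) := by
      rw [mul_sum, ← sum_sub_distrib]
      refine sum_congr rfl fun i _ => ?_
      simp only [vec, s, mem_filter, mem_univ, true_and, sign]
      cases σ i <;> simp only [if_true, Bool.false_eq_true, if_false] <;> ring
    rw [this]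
    ring
  rw [hdiff, abs_div, abs_of_pos (by positivity : (0 : ℝ) < 2 * Fintype.card ι)]
  gcongr
  exact hle.trans (by gcongr)

/-- The error of the halving step from `2 ^ (j + 1)` to `2 ^ j` points. -/
noncomputable def halvingError (d j : ℕ) : ℝ :=
  (Real.log (2 * (d + 1)) + d * Real.log 4 * (j + 1)) / 2 * (2 / 3) ^ j + (3 / 4) ^ j / 4

theorem halvingError_nonneg (d j : ℕ) : 0 ≤ halvingError d j := by
  have h1 : 0 ≤ Real.log (2 * ((d : ℝ) + 1)) := Real.log_nonneg (by linarith [d.cast_nonneg (α := ℝ)])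
  have h2 : 0 ≤ Real.log 4 := Real.log_nonneg (by norm_num)
  unfold halvingError
  positivity

theorem summable_halvingError (d : ℕ) : Summable (halvingError d) := by
  unfold halvingError
  refine Summable.add ?_ ((summable_geometric_of_lt_one (by norm_num) (by norm_num)).div_const _)
  have h0 : Summable fun j : ℕ => ((2 : ℝ) / 3) ^ j :=
    summable_geometric_of_lt_one (by norm_num) (by norm_num)
  have h1 : Summable fun j : ℕ => (j : ℝ) ^ 1 * ((2 : ℝ) / 3) ^ j :=
    summable_pow_mul_geometric_of_norm_lt_one 1 (by norm_num)
  refine ((h0.mul_left ((Real.log (2 * ((d : ℝ) + 1)) + d * Real.log 4) / 2)).add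
    (h1.mul_left (d * Real.log 4 / 2))).congr fun j => ?_
  ring

theorem exists_halving_two_pow {X : Type*} {C : Type*} {S : C → Set X} {d : ℕ}
    (hS : ShattersNone S (d + 1)) (j : ℕ) (x : Fin (2 ^ (j + 1)) → X) :
    ∃ y : Fin (2 ^ j) → X, ∀ c, |freq y (S c) - freq x (S c)| ≤ halvingError d j := by
  let e : Fin (2 ^ j) × Bool ≃ Fin (2 ^ (j + 1)) :=
    Fintype.equivFinOfCardEq (by simp [pow_succ])
  -- This `t` tends to `0`, while `t * 2 ^ j = (3 / 2) ^ j` outgrows the logarithm, which is linear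
  -- in `j`; hence both error terms are summable.
  obtain ⟨y, hy⟩ := exists_halving hS (x ∘ e) (t := (3 / 4) ^ j) (by positivity)
  refine ⟨y, fun c => ?_⟩
  have h := hy c
  rw [freq_comp_equiv] at h
  refine h.trans ?_
  have hcard : (Fintype.card (Fin (2 ^ j)) : ℝ) = 2 ^ j := by simp
  rw [hcard]
  have hlog : Real.log (2 * (((d : ℝ) + 1) * (2 * 2 ^ j + 1) ^ d)) ≤
      Real.log (2 * (d + 1)) + d * Real.log 4 * (j + 1) := by
    have h4 : (2 : ℝ) * 2 ^ j + 1 ≤ 4 ^ (j + 1) := by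
      have : (4 : ℝ) ^ (j + 1) = 4 * (2 ^ j * 2 ^ j) := by
        rw [pow_succ, ← mul_pow]
        norm_num
        ring
      nlinarith [one_le_pow₀ (by norm_num : (1 : ℝ) ≤ 2) (n := j)]
    rw [← mul_assoc, Real.log_mul (by positivity) (by positivity), Real.log_pow, mul_assoc]
    gcongr
    refine (Real.log_le_log (by positivity) h4).trans (le_of_eq ?_)
    rw [Real.log_pow]
    push_cast
    ring
  have h23 : ((2 : ℝ) / 3) ^ j = 1 / ((3 / 4) ^ j * 2 ^ j) := by
    rw [← mul_pow, ← one_div_pow]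
    norm_num
  rw [halvingError, h23]
  calc _ ≤ ((Real.log (2 * (d + 1)) + d * Real.log 4 * (j + 1)) / (3 / 4) ^ j +
        (3 / 4) ^ j * 2 ^ j / 2) / (2 * 2 ^ j) := by gcongr
    _ = _ := by
        field_simp
        ring

/-- A sample of `2 ^ J` points suffices to approximate any larger dyadic sample, where `J` depends
only on the Vapnik–Chervonenkis dimension and the precision. -/
theorem exists_forall_two_pow_approx (d : ℕ) {ε : ℝ} (hε : 0 < ε) :
    ∃ J : ℕ, ∀ {X : Type u} {C : Type v} {S : C → Set X}, ShattersNone S (d + 1) →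
      ∀ (m : ℕ) (x : Fin (2 ^ (J + m)) → X), ∃ y : Fin (2 ^ J) → X,
        ∀ c, |freq y (S c) - freq x (S c)| ≤ ε := by
  -- Halving stops at `2 ^ J` points, where the whole tail of errors is below `ε` however large the
  -- initial sample.
  obtain ⟨J, hJ⟩ := ((tendsto_sum_nat_add (halvingError d)).eventually (gt_mem_nhds hε)).exists
  refine ⟨J, fun {X C S} hS m x => ?_⟩
  have key : ∀ (m : ℕ) (x : Fin (2 ^ (J + m)) → X), ∃ y : Fin (2 ^ J) → X,
      ∀ c, |freq y (S c) - freq x (S c)| ≤ ∑ k ∈ range m, halvingError d (k + J) := by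
    intro m
    induction m with
    | zero => exact fun x => ⟨x, by simp⟩
    | succ m ih =>
      intro x
      obtain ⟨z, hz⟩ := exists_halving_two_pow hS (J + m) x
      obtain ⟨y, hy⟩ := ih z
      refine ⟨y, fun c => ?_⟩
      rw [sum_range_succ, add_comm m J]
      exact (abs_sub_le _ (freq z (S c)) _).trans (add_le_add (hy c) (hz c))
  obtain ⟨y, hy⟩ := key m x
  refine ⟨y, fun c => (hy c).trans (le_trans ?_ hJ.le)⟩
  exact ((summable_nat_add_iff J).2 (summable_halvingError d)).sum_le_tsum _
    fun k _ => halvingError_nonneg d _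

/-- The dual of a family shattering no `n` points shatters no `2 ^ n` points. -/
theorem ShattersNone.dual {X : Type*} {C : Type*} {S : C → Set X} {n : ℕ}
    (h : ShattersNone S n) : ShattersNone (fun x => {c | x ∈ S c}) (2 ^ n) := by
  classical
  intro y hy
  -- Index the `2 ^ n` dual points by subsets of `Fin n`, and let `x i` belong to exactly those
  -- whose index contains `i`.
  let e : Set (Fin n) ≃ Fin (2 ^ n) := Fintype.equivFinOfCardEq (by simp)
  choose x hx using fun i : Fin n => hy {j | i ∈ e.symm j}
  refine h x fun s => ⟨y (e s), fun i => ?_⟩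
  simpa using hx i (e s)

end EpsilonApproximation

namespace FirstOrder.Language

open EpsilonApproximation

/-! ### Approximation of Keisler measures by averages of types -/

section

variable {L : Language.{u, v}} {M : Type w} [L.Structure M] {A : Set M} {α : Type u'}

namespace KeislerMeasure

theorem map_bot (l : KeislerMeasure L A α) : l.toFun ⊥ = 0 := by
  have := l.map_sup' ⊥ ⊥ disjoint_bot_left
  rw [sup_idem] at this
  linarith

theorem map_inf_add_map_inf_compl (l : KeislerMeasure L A α) (s t : L.DefinableSet A α) :
    l.toFun (s ⊓ t) + l.toFun (s ⊓ tᶜ) = l.toFun s := by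
  rw [← l.map_sup' _ _ ((disjoint_compl_right (a := t)).mono inf_le_right inf_le_right),
    ← inf_sup_left, sup_compl_eq_top, inf_top_eq]

open Classical in
/-- On finitely many definable sets, a Keisler measure agrees with a measure of finite support. -/
theorem exists_finite_support (l : KeislerMeasure L A α) (B : Finset (L.DefinableSet A α)) :
    ∀ s : L.DefinableSet A α, ∃ (ι : Type) (_ : Fintype ι) (w : ι → ℝ) (x : ι → α → M),
      (∀ i, 0 ≤ w i) ∧ (∀ i, x i ∈ s) ∧ ∑ i, w i = l.toFun s ∧
        ∀ t ∈ B, (∑ i, if x i ∈ t then w i else 0) = l.toFun (s ⊓ t) := by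
  induction B using Finset.induction_on with
  | empty =>
    intro s
    by_cases hs : ∃ x, x ∈ s
    · obtain ⟨x, hx⟩ := hs
      exact ⟨Unit, inferInstance, fun _ => l.toFun s, fun _ => x, fun _ => l.nonneg' s,
        fun _ => hx, by simp, by simp⟩
    · have : s = ⊥ := SetLike.ext fun x => iff_of_false (fun h => hs ⟨x, h⟩) (by simp)
      exact ⟨Empty, inferInstance, Empty.elim, Empty.elim, fun i => i.elim, fun i => i.elim,
        by simp [this, map_bot], by simp⟩
  | insert b B _ ih =>
    intro s
    -- Cut `s` along `b` and place the two supports on either side; this is why the induction ranges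
    -- over all `s`.
    obtain ⟨ι₁, _, w₁, x₁, hw₁, hx₁, hs₁, h₁⟩ := ih (s ⊓ b)
    obtain ⟨ι₂, _, w₂, x₂, hw₂, hx₂, hs₂, h₂⟩ := ih (s ⊓ bᶜ)
    refine ⟨ι₁ ⊕ ι₂, inferInstance, Sum.elim w₁ w₂, Sum.elim x₁ x₂, ?_, ?_, ?_, ?_⟩
    · rintro (i | i)
      exacts [hw₁ i, hw₂ i]
    · rintro (i | i)
      exacts [(hx₁ i).1, (hx₂ i).1]
    · simp [hs₁, hs₂, map_inf_add_map_inf_compl]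
    · intro t ht
      simp only [Fintype.sum_sum_type, Sum.elim_inl, Sum.elim_inr]
      rcases Finset.mem_insert.1 ht with rfl | ht
      · have e₁ (i : ι₁) : x₁ i ∈ t := (hx₁ i).2
        have e₂ (i : ι₂) : x₂ i ∉ t := (hx₂ i).2
        simp [e₁, e₂, hs₁]
      · refine (congrArg₂ (· + ·) (h₁ t ht) (h₂ t ht)).trans ?_
        rw [inf_right_comm, inf_right_comm s bᶜ, map_inf_add_map_inf_compl]

open Classical in
/-- On finitely many definable sets, a Keisler measure is approximated by the frequencies of all
sufficiently large dyadic samples. -/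
theorem exists_sample [Nonempty M] (l : KeislerMeasure L A α) (B : Finset (L.DefinableSet A α))
    {ε : ℝ} (hε : 0 < ε) :
    ∃ K : ℕ, ∀ m, K ≤ m → ∃ x : Fin (2 ^ m) → α → M,
      ∀ t ∈ B, |freq x (t : Set (α → M)) - l.toFun t| ≤ ε := by
  obtain ⟨ι, _, w, x, hw, -, hsum, h⟩ := l.exists_finite_support B ⊤
  rw [l.map_top'] at hsum
  simp only [top_inf_eq] at h
  obtain ⟨K, hK⟩ := pow_unbounded_of_one_lt (Fintype.card ι / ε) (one_lt_two (α := ℝ))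
  refine ⟨K, fun m hm => ?_⟩
  have hN : (0 : ℝ) < 2 ^ m := by positivity
  -- Multiplicities are weights rounded down. The `r ≤ |ι|` points left over are placed at an
  -- arbitrary tuple, which costs at most `|ι| / 2 ^ m ≤ ε`.
  let c (i : ι) : ℕ := ⌊2 ^ m * w i⌋₊
  have hc₀ (i : ι) : (c i : ℝ) ≤ 2 ^ m * w i := Nat.floor_le (mul_nonneg hN.le (hw i))
  have hc₁ (i : ι) : 2 ^ m * w i - c i ≤ 1 := by linarith [Nat.lt_floor_add_one (2 ^ m * w i)]
  have hle : ∑ i, c i ≤ 2 ^ m := by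
    have : (∑ i, (c i : ℝ)) ≤ 2 ^ m := by
      refine (Finset.sum_le_sum fun i _ => hc₀ i).trans (le_of_eq ?_)
      rw [← Finset.mul_sum, hsum, mul_one]
    exact_mod_cast this
  obtain ⟨r, hr⟩ := Nat.exists_eq_add_of_le hle
  have hr' : (r : ℝ) = ∑ i, (2 ^ m * w i - c i) := by
    rw [Finset.sum_sub_distrib, ← Finset.mul_sum, hsum, mul_one, eq_sub_iff_add_eq, add_comm]
    exact_mod_cast hr.symm
  have hrle : (r : ℝ) ≤ Fintype.card ι := by
    rw [hr']
    exact (Finset.sum_le_card_nsmul _ _ 1 fun i _ => hc₁ i).trans (by simp)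
  let e : Fin (2 ^ m) ≃ (Σ i : ι, Fin (c i)) ⊕ Fin r :=
    (Fintype.equivFinOfCardEq (by simp [hr])).symm
  let z : (Σ i : ι, Fin (c i)) ⊕ Fin r → α → M :=
    Sum.elim (fun p => x p.1) fun _ _ => Classical.arbitrary M
  refine ⟨z ∘ e, fun t ht => ?_⟩
  have hcard : Fintype.card ((Σ i : ι, Fin (c i)) ⊕ Fin r) = 2 ^ m := by simp [hr]
  rw [freq_comp_equiv, freq, hcard, ← h t ht]
  push_cast
  rw [div_sub' hN.ne', abs_div, abs_of_pos hN, div_le_iff₀ hN]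
  have hcardle : (Fintype.card ι : ℝ) ≤ ε * 2 ^ m := by
    have := hK.le.trans (pow_le_pow_right₀ one_le_two hm)
    rwa [div_le_iff₀ hε, mul_comm] at this
  refine le_trans ?_ hcardle
  have hz : (∑ p, if z p ∈ (t : Set (α → M)) then (1 : ℝ) else 0) =
      (∑ i, (c i : ℝ) * if x i ∈ t then 1 else 0) +
        r * if (fun _ : α => Classical.arbitrary M) ∈ t then 1 else 0 := by
    rw [Fintype.sum_sum_type, Fintype.sum_sigma]
    refine congrArg₂ (· + ·) (Finset.sum_congr rfl fun i _ => ?_) ?_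
    · exact (Finset.sum_const (if x i ∈ t then (1 : ℝ) else 0)).trans (by simp)
    · exact (Finset.sum_const
        (if (fun _ : α => Classical.arbitrary M) ∈ t then (1 : ℝ) else 0)).trans (by simp)
  rw [hz, Finset.mul_sum]
  rw [add_sub_right_comm, ← Finset.sum_sub_distrib]
  have h₁ : (∑ i, ((c i : ℝ) * (if x i ∈ t then 1 else 0) - 2 ^ m * if x i ∈ t then w i else 0)) ≤
      0 := Finset.sum_nonpos fun i _ => by split_ifs <;> linarith [hc₀ i]
  have h₂ : -(Fintype.card ι : ℝ) ≤
      ∑ i, ((c i : ℝ) * (if x i ∈ t then 1 else 0) - 2 ^ m * if x i ∈ t then w i else 0) := by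
    have := Finset.card_nsmul_le_sum Finset.univ
      (fun i => (c i : ℝ) * (if x i ∈ t then 1 else 0) - 2 ^ m * if x i ∈ t then w i else 0) (-1)
      fun i _ => by split_ifs <;> linarith [hc₁ i]
    simpa using this
  have h₃ : (r : ℝ) * (if (fun _ : α => Classical.arbitrary M) ∈ t then 1 else 0) ∈
      Set.Icc (0 : ℝ) (Fintype.card ι) := by
    have : (0 : ℝ) ≤ r := r.cast_nonneg
    split_ifs
    · simpa using hrle
    · simp
  rw [abs_le]
  constructor <;> linarith [h₃.1, h₃.2]

end KeislerMeasure

open Classical in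
/-- The limit of the types of the tuples `x j` along an ultrafilter. -/
noncomputable def limitType {J : Type*} (U : Ultrafilter J) (x : J → α → M) :
    BoundedLatticeHom (L.DefinableSet A α) Bool where
  toFun s := decide (∀ᶠ j in (U : Filter J), x j ∈ s)
  map_sup' s t := by simp [Ultrafilter.eventually_or]
  map_inf' s t := by simp [Filter.eventually_and]
  map_top' := by simp
  map_bot' := by simp [U.neBot.ne]

theorem limitType_eq_true {J : Type*} {U : Ultrafilter J} {x : J → α → M}
    {s : L.DefinableSet A α} : limitType U x s = true ↔ ∀ᶠ j in (U : Filter J), x j ∈ s := by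
  simp [limitType]

/-- On a family of definable sets of bounded Vapnik–Chervonenkis dimension, each Keisler measure is
approximated by the average of `N` complete types, where `N` depends only on the dimension and the
precision. -/
theorem exists_forall_average_approx [Nonempty M] {C : Type w} {S : C → L.DefinableSet A α} {d : ℕ}
    (hS : ShattersNone (fun c => (S c : Set (α → M))) (d + 1)) {ε : ℝ} (hε : 0 < ε) :
    ∃ N : ℕ, 0 < N ∧ ∀ l : KeislerMeasure L A α,
      ∃ p : Fin N → BoundedLatticeHom (L.DefinableSet A α) Bool,
        ∀ c, |(∑ i, if p i (S c) then (1 : ℝ) else 0) / N - l.toFun (S c)| ≤ ε := by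
  classical
  obtain ⟨J, hJ⟩ := exists_forall_two_pow_approx.{max u' w, w} d (half_pos hε)
  refine ⟨2 ^ J, by positivity, fun l => ?_⟩
  have hfin (B : Finset C) : ∃ y : Fin (2 ^ J) → α → M,
      ∀ c ∈ B, |freq y (S c : Set (α → M)) - l.toFun (S c)| ≤ ε := by
    obtain ⟨K, hK⟩ := l.exists_sample (B.image S) (half_pos hε)
    obtain ⟨x, hx⟩ := hK (J + K) (Nat.le_add_left _ _)
    obtain ⟨y, hy⟩ := hJ hS K x
    refine ⟨y, fun c hc => ?_⟩
    have := (abs_sub_le _ _ _).trans (add_le_add (hy c) (hx _ (Finset.mem_image_of_mem S hc)))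
    rwa [add_halves] at this
  choose y hy using hfin
  -- Compactness: the sample size does not depend on `B`, so the samples converge coordinatewise to
  -- complete types along an ultrafilter containing every `{B | c ∈ B}`.
  let U : Ultrafilter (Finset C) := Ultrafilter.of Filter.atTop
  refine ⟨fun i => limitType U fun B => y B i, fun c => ?_⟩
  have hmem : ∀ᶠ B in (U : Filter (Finset C)), c ∈ B :=
    Ultrafilter.of_le _ ((Filter.eventually_ge_atTop {c}).mono fun B hB => by simpa using hB)
  have hev (i : Fin (2 ^ J)) : ∀ᶠ B in (U : Filter (Finset C)),
      (limitType U (fun B => y B i) (S c) = true ↔ y B i ∈ S c) := by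
    rw [limitType_eq_true]
    by_cases h : ∀ᶠ B in (U : Filter (Finset C)), y B i ∈ S c
    · exact h.mono fun B hB => iff_of_true h hB
    · exact (Ultrafilter.eventually_not.2 h).mono fun B hB => iff_of_false h hB
  obtain ⟨B, hB, hBe⟩ := (hmem.and (Filter.eventually_all.2 hev)).exists
  have := hy B c hB
  simp only [freq, SetLike.mem_coe, Fintype.card_fin] at this
  simpa only [hBe] using this

end

/-! ### From NIP to bounded Vapnik–Chervonenkis dimension -/

section

variable {L : Language.{u, v}}

open Classical in
/-- The formula in the parameters `a` and the tuple `b` saying that `φ (b; a i)` holds if and only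
if `i ∈ s`. -/
noncomputable def traceFormula {k m : ℕ} (φ : L.Formula (Fin k ⊕ Fin m)) {N : ℕ}
    (s : Set (Fin N)) (i : Fin N) : L.Formula ((Empty ⊕ (Fin N × Fin m)) ⊕ Fin k) :=
  let ψ : L.Formula ((Empty ⊕ (Fin N × Fin m)) ⊕ Fin k) :=
    φ.relabel (Sum.elim Sum.inr fun j => Sum.inl (Sum.inr (i, j)))
  if i ∈ s then ψ else ψ.not

theorem realize_traceFormula {k m : ℕ} (φ : L.Formula (Fin k ⊕ Fin m)) {N : ℕ}
    (s : Set (Fin N)) (i : Fin N) {M : Type*} [L.Structure M] (z : Empty → M)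
    (a : Fin N × Fin m → M) (b : Fin k → M) :
    (traceFormula φ s i).Realize (Sum.elim (Sum.elim z a) b) ↔
      (φ.Realize (Sum.elim b fun j => a (i, j)) ↔ i ∈ s) := by
  have hcomp : Sum.elim (Sum.elim z a) b ∘ Sum.elim Sum.inr (fun j => Sum.inl (Sum.inr (i, j))) =
      Sum.elim b fun j => a (i, j) := by
    funext j
    rcases j with j | j <;> rfl
  by_cases hi : i ∈ s <;> simp [traceFormula, hi, Formula.realize_relabel, hcomp]

/-- The sentence saying that the formula `φ` shatters some `N` parameters. -/
noncomputable def shatterSentence {k m : ℕ} (φ : L.Formula (Fin k ⊕ Fin m)) (N : ℕ) :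
    L.Sentence :=
  Formula.iExs (α := Empty) (Fin N × Fin m) <| Formula.iInf fun s : Set (Fin N) =>
    Formula.iExs (Fin k) <| Formula.iInf fun i : Fin N => traceFormula φ s i

theorem realize_shatterSentence {k m : ℕ} (φ : L.Formula (Fin k ⊕ Fin m)) (N : ℕ)
    (M : Type*) [L.Structure M] :
    M ⊨ shatterSentence φ N ↔ ∃ a : Fin N → Fin m → M, ∀ s : Set (Fin N), ∃ b : Fin k → M,
      ∀ i, φ.Realize (Sum.elim b (a i)) ↔ i ∈ s := by
  simp only [shatterSentence, Sentence.Realize, Formula.realize_iExs, Formula.realize_iInf,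
    realize_traceFormula]
  exact ⟨fun ⟨a, h⟩ => ⟨fun i j => a (i, j), h⟩, fun ⟨a, h⟩ => ⟨fun p => a p.1 p.2, h⟩⟩

/-- In a complete NIP theory, the bound on shattered parameters holds in models in all universes. -/
theorem Theory.IsNIP.exists_forall_model {T : L.Theory} (hNIP : T.IsNIP) (hT : T.IsComplete)
    {k m : ℕ} (φ : L.Formula (Fin k ⊕ Fin m)) :
    ∃ N : ℕ, ∀ (M : Type w) [L.Structure M] [Nonempty M] [M ⊨ T] (a : Fin N → Fin m → M),
      ¬ ∀ s : Set (Fin N), ∃ b : Fin k → M, ∀ i, φ.Realize (Sum.elim b (a i)) ↔ i ∈ s := by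
  obtain ⟨N, hN⟩ := hNIP k m φ
  refine ⟨N, fun M _ _ _ a ha => ?_⟩
  obtain ⟨M'⟩ := hT.1
  -- Shattering is a first-order sentence, so completeness moves it to a model in the universe of
  -- `IsNIP`.
  have h : M ⊨ shatterSentence φ N := (realize_shatterSentence φ N M).2 ⟨a, ha⟩
  rw [hT.realize_sentence_iff, ← hT.realize_sentence_iff _ M', realize_shatterSentence] at h
  obtain ⟨a', ha'⟩ := h
  exact hN M' a' ha'

variable {M : Type w} [L.Structure M]

theorem Formula.exists_finite_variables {β : Type*} (ψ : L.Formula β) :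
    ∃ (k : ℕ) (v : Fin k → β) (ψ' : L.Formula (Fin k)),
      ∀ x : β → M, ψ'.Realize (x ∘ v) ↔ ψ.Realize x := by
  classical
  let e := ψ.freeVarFinset.equivFin
  exact ⟨_, fun i => e.symm i, ψ.restrictFreeVar e, fun x =>
    BoundedFormula.realize_restrictFreeVar x fun a => by simp⟩

variable {A : Set M} {α : Type u'}

/-- In a NIP theory, the instances over `A` of a formula have bounded Vapnik–Chervonenkis
dimension. -/
theorem Theory.IsNIP.exists_shattersNone {T : L.Theory} (hNIP : T.IsNIP) (hT : T.IsComplete)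
    [Nonempty M] [M ⊨ T] {n : ℕ} (φ : L.Formula (α ⊕ Fin n)) :
    ∃ d : ℕ, ShattersNone (fun a : Fin n → A =>
      ((DefinableSet.inst φ a : L.DefinableSet A α) : Set (α → M))) (d + 1) := by
  obtain ⟨k, v, ψ, hψ⟩ := φ.exists_finite_variables (M := M)
  obtain ⟨N, hN⟩ := hNIP.exists_forall_model.{u, v, w} hT (ψ.relabel fun i =>
    (Sum.elim (fun _ => Sum.inl i) Sum.inr (v i) : Fin k ⊕ Fin n))
  -- NIP bounds the parameters shattered by points, which is the dual of the required class.
  have hdual : ShattersNone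
      (fun x : α → M => {a : Fin n → A | φ.Realize (Sum.elim x fun i => (a i : M))}) N := by
    intro a ha
    refine hN M (fun i j => a i j) fun s => ?_
    obtain ⟨x, hx⟩ := ha s
    -- The arbitrary value fills slots whose variable is a parameter; the relabelled formula does
    -- not use them.
    refine ⟨fun i => Sum.elim x (fun _ => Classical.arbitrary M) (v i), fun i => ?_⟩
    rw [← hx i, Set.mem_ofPred_eq, ← hψ, Formula.realize_relabel]
    refine iff_of_eq (congrArg _ ?_)
    funext j
    simp only [Function.comp_apply]
    rcases hj : v j with i | i <;> simp [hj]
  refine ⟨2 ^ N - 1, ?_⟩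
  rw [Nat.sub_add_cancel Nat.one_le_two_pow]
  exact hdual.dual

/-- Only finitely many parameters occur in a formula, so a measure is determined by its values on
instances. -/
theorem DefinableSet.exists_eq_inst (s : L.DefinableSet A α) :
    ∃ (n : ℕ) (φ : L.Formula (α ⊕ Fin n)) (a : Fin n → A), s = DefinableSet.inst φ a := by
  classical
  obtain ⟨ψ, hψ⟩ := Set.definable_iff_exists_formula_sum.1 s.2
  let e := ψ.freeVarFinset.toLeft.equivFin
  let f : ψ.freeVarFinset → α ⊕ Fin ψ.freeVarFinset.toLeft.card
    | ⟨Sum.inl a, h⟩ => Sum.inr (e ⟨a, Finset.mem_toLeft.2 h⟩)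
    | ⟨Sum.inr i, _⟩ => Sum.inl i
  refine ⟨_, ψ.restrictFreeVar f, fun i => (e.symm i : A), Subtype.ext (hψ.trans ?_)⟩
  ext x
  refine (BoundedFormula.realize_restrictFreeVar _ ?_).symm
  rintro ⟨a | i, h⟩ <;> simp [f]

end

/-! ### Counting parameter-free formulas, and assembling the sequence of types -/

theorem card_sigma_formula_le {L : Language.{u, v}} {α : Type u'} :
    #(Σ n : ℕ, L.Formula (α ⊕ Fin n)) ≤
      Cardinal.lift.{u'} (max ℵ₀ L.card) + Cardinal.lift.{max u v} #α := by
  set κ := Cardinal.lift.{u'} (max ℵ₀ L.card) + Cardinal.lift.{max u v} #α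
  have hκ : ℵ₀ ≤ κ := le_add_right (by simp)
  have hn (n : ℕ) : #(L.Formula (α ⊕ Fin n)) ≤ κ := by
    have hinj : Function.Injective
        fun φ : L.Formula (α ⊕ Fin n) => (⟨0, φ⟩ : Σ k, L.BoundedFormula (α ⊕ Fin n) k) :=
      fun _ _ h => by simpa using h
    refine (mk_le_of_injective hinj).trans (BoundedFormula.card_le.trans (max_le hκ ?_))
    rw [mk_sum, lift_add, add_right_comm]
    simp only [Cardinal.lift_lift]
    refine add_le_of_le hκ ?_ ?_
    · rw [add_comm]
      exact add_le_add (by simp) le_rfl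
    · exact le_trans (by simp) hκ
  rw [mk_sigma]
  refine (sum_le_sum _ (fun _ => κ) hn).trans ?_
  rw [sum_const]
  simpa using mul_le_of_le hκ hκ le_rfl

end FirstOrder.Language

theorem mainTheorem12 {L : FirstOrder.Language.{u, v}} (T : L.Theory) (hT : T.IsComplete)
    (hNIP : T.IsNIP) {M : Type w} [L.Structure M] [Nonempty M] [M ⊨ T] (A : Set M)
    (α : Type u') (I : Type w')
    (hI : Cardinal.lift.{max u v u'} #I =
      Cardinal.lift.{w'} (Cardinal.lift.{u'} (max ℵ₀ L.card) + Cardinal.lift.{max u v} #α)) :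
    ∃ f : KeislerMeasure L A α → BooleanType L A α (I → Bool),
      Function.Injective f ∧
        ∀ l₁ l₂ : KeislerMeasure L A α,
          BooleanType.ElementarilyConjugate (f l₁) (f l₂) → l₁.Conjugate l₂ := by
  classical
  choose d hd using fun q : Σ n : ℕ, L.Formula (α ⊕ Fin n) =>
    hNIP.exists_shattersNone (A := A) hT q.2
  have approx (q : (Σ n : ℕ, L.Formula (α ⊕ Fin n)) × ℕ) :=
    exists_forall_average_approx (hd q.1) (Nat.one_div_pos_of_nat (α := ℝ) (n := q.2))
  choose N hN p hp using approx
  obtain ⟨e⟩ : Nonempty ((Σ q : (Σ n : ℕ, L.Formula (α ⊕ Fin n)) × ℕ, Fin (N q)) ↪ I) := by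
    rw [← Cardinal.lift_mk_le', hI, Cardinal.lift_le]
    set κ := Cardinal.lift.{u'} (max ℵ₀ L.card) + Cardinal.lift.{max u v} #α with hκ_def
    have hκ : ℵ₀ ≤ κ := le_add_right (by simp)
    have hinj : Function.Injective
        fun x : Σ q : (Σ n : ℕ, L.Formula (α ⊕ Fin n)) × ℕ, Fin (N q) => (x.1, (x.2 : ℕ)) := by
      rintro ⟨q, i⟩ ⟨q', i'⟩ h
      obtain ⟨rfl, h⟩ := Prod.mk.inj h
      exact congrArg (Sigma.mk q) (Fin.ext h)
    refine (mk_le_of_injective hinj).trans ?_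
    simp only [mk_prod, Cardinal.lift_id', mk_nat, lift_aleph0]
    exact mul_le_of_le hκ (mul_le_of_le hκ (card_sigma_formula_le.trans hκ_def.ge) hκ) hκ
  have : Nonempty (Σ q : (Σ n : ℕ, L.Formula (α ⊕ Fin n)) × ℕ, Fin (N q)) :=
    ⟨⟨(⟨0, ⊤⟩, 0), ⟨0, hN _⟩⟩⟩
  -- Positions outside the range of `e` repeat some type from the blocks; they play no role in the
  -- recovery.
  let g := Function.invFun e
  have hg (x) : g (e x) = x := Function.leftInverse_invFun e.injective x
  let f (l : KeislerMeasure L A α) : BooleanType L A α (I → Bool) :=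
    { toFun := fun s i => p (g i).1 l (g i).2 s
      map_sup' := fun s t => funext fun i => map_sup (p (g i).1 l (g i).2) s t
      map_inf' := fun s t => funext fun i => map_inf (p (g i).1 l (g i).2) s t
      map_top' := funext fun i => map_top (p (g i).1 l (g i).2)
      map_bot' := funext fun i => map_bot (p (g i).1 l (g i).2) }
  have transfer (π : A ≃ A) (l₁ l₂ : KeislerMeasure L A α)
      (h : IsTranslate π (f l₁ : L.DefinableSet A α → I → Bool) (f l₂)) :
      IsTranslate π l₁.toFun l₂.toFun := by
    intro n φ a
    refine eq_of_forall_dist_le fun ε hε => ?_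
    obtain ⟨k, hk⟩ := exists_nat_one_div_lt (half_pos hε)
    have h₁ := hp (⟨n, φ⟩, k) l₁ fun i => π.symm (a i)
    have h₂ := hp (⟨n, φ⟩, k) l₂ a
    -- The block of `(φ, k)` sits at the same positions for both measures, so the two averages
    -- coincide after translation by `π`.
    have heq (i : Fin (N (⟨n, φ⟩, k))) : p (⟨n, φ⟩, k) l₁ i (DefinableSet.inst φ fun i =>
        π.symm (a i)) = p (⟨n, φ⟩, k) l₂ i (DefinableSet.inst φ a) := by
      have := congrFun (h n φ a) (e ⟨(⟨n, φ⟩, k), i⟩)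
      change p (g _).1 l₁ (g _).2 _ = p (g _).1 l₂ (g _).2 _ at this
      rwa [hg] at this
    simp only [heq] at h₁
    rw [Real.dist_eq]
    rw [abs_sub_comm] at h₁
    linarith [abs_sub_le _ _ _ |>.trans (add_le_add h₁ h₂)]
  refine ⟨f, fun l₁ l₂ h => ?_, fun l₁ l₂ ⟨π, hπ, h⟩ => ⟨π, hπ, transfer π l₁ l₂ h⟩⟩
  have := transfer (Equiv.refl A) l₁ l₂ fun n φ a => by rw [h]; rfl
  refine KeislerMeasure.ext (funext fun s => ?_)
  obtain ⟨n, φ, a, rfl⟩ := s.exists_eq_inst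
  exact this n φ a
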